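/- Let $\mathbf{Z}[\mathbb{R}]$ denote the collection of zero sets $\mathbf{Z}(f)=\{x\in\mathbb{R}: f(x)=0\}$ of continuous functions $f$ on $\mathbb{R}$. A $z$-filter on $\mathbb{R}$ is a non-empty proper subset of $\mathbf{Z}[\mathbb{R}]$ that is closed under finite intersections and under supersets in $\mathbf{Z}[\mathbb{R}]$. A $z$-filter $\mathcal{P}$ is prime if $Z_1\cup Z_2\notin\mathcal{P}$ whenever $Z_1,Z_2\in\mathbf{Z}[\mathbb{R}]\setminus\mathcal{P}$; a prime $z$-filter is non-minimal if it properly contains another prime $z$-filter. Let $\mathcal{C}_0(\mathbb{R})$ be the algebra of continuous (real-valued or complex-valued) functions on $\mathbb{R}$ vanishing at infinity. An ideal $P$ of $\mathcal{C}_0(\mathbb{R})$ is prime if it is proper and $fg\in P$ implies $f\in P$ or $g\in P$; it is a $z$-ideal if $g\in P$ whenever $g\in\mathcal{C}_0(\mathbb{R})$ and $\mathbf{Z}(g)\supseteq\mathbf{Z}(f)$ for some $f\in P$; a prime $z$-ideal is non-minimal if it properly contains another prime ideal. Let $\kappa$ be any ordinal of cardinality $\mathfrak{c}=2^{\aleph_0}$.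 Then: (i) For every non-minimal prime $z$-filter $\mathcal{P}$ on $\mathbb{R}$ there is a family $(\mathcal{Q}_\alpha)_{\alpha<\kappa}$ of prime $z$-filters on $\mathbb{R}$ such that $\mathcal{Q}_0=\mathcal{P}$ and $\mathcal{Q}_\beta\subsetneq\mathcal{Q}_\alpha$ whenever $\alpha<\beta<\kappa$. (ii) For every non-minimal prime $z$-ideal $P$ of $\mathcal{C}_0(\mathbb{R})$ there is a family $(Q_\alpha)_{\alpha<\kappa}$ of prime $z$-ideals of $\mathcal{C}_0(\mathbb{R})$ such that $Q_0=P$ and $Q_\beta\subsetneq Q_\alpha$ whenever $\alpha<\beta<\kappa$. -/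

import Mathlib

open scoped ZeroAtInfty

universe u v

namespace PrimeZ

/-- `Z[Ω]`: the collection of the zero sets of the continuous real functions on `Ω`. (Complex
functions have the same zero sets, since `f` and `|f|` vanish at the same points.) -/
def zeroSets (Ω : Type*) [TopologicalSpace Ω] : Set (Set Ω) :=
  {Z | ∃ f : C(Ω, ℝ), Z = {x | f x = 0}}

/-- A `z`-filter on `Ω`: a non-empty proper subset of `Z[Ω]` closed under finite intersections and
under supersets in `Z[Ω]`. -/
structure IsZFilter {Ω : Type*} [TopologicalSpace Ω] (F : Set (Set Ω)) : Prop where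
  nonempty : F.Nonempty
  ssubset : F ⊂ zeroSets Ω
  inter_mem : ∀ Z ∈ F, ∀ W ∈ F, Z ∩ W ∈ F
  superset_mem : ∀ Z ∈ F, ∀ W ∈ zeroSets Ω, Z ⊆ W → W ∈ F

/-- A prime `z`-filter: zero sets `Z`, `W` outside of it have their union outside of it. -/
structure IsPrimeZFilter {Ω : Type*} [TopologicalSpace Ω] (F : Set (Set Ω)) : Prop where
  isZFilter : IsZFilter F
  union_notMem : ∀ Z ∈ zeroSets Ω, ∀ W ∈ zeroSets Ω, Z ∉ F → W ∉ F → Z ∪ W ∉ F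

/-- A prime ideal of the commutative (possibly non-unital) ring `R`: a proper ideal that contains
one of the factors of any product that it contains. -/
structure IsPrimeIdeal {R : Type*} [NonUnitalCommRing R] (I : TwoSidedIdeal R) : Prop where
  ne_top : I ≠ ⊤
  mem_or_mem : ∀ f g : R, f * g ∈ I → f ∈ I ∨ g ∈ I

/-- A `z`-ideal of `C₀(Ω, 𝕜)`: with `f` it contains all `g` that vanish wherever `f` does. -/
def IsZIdeal {Ω 𝕜 : Type*} [TopologicalSpace Ω] [RCLike 𝕜] (I : TwoSidedIdeal C₀(Ω, 𝕜)) : Prop :=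
  ∀ f ∈ I, ∀ g : C₀(Ω, 𝕜), {x | f x = 0} ⊆ {x | g x = 0} → g ∈ I

end PrimeZ

/-!
Closed sets of a topological space form a co-Heyting algebra, with boundary `∂ C = C ∩ closure Cᶜ`,
and on a metric space the prime `z`-filters are the complements of its prime ideals; so below a
prime `z`-filter one looks for a long chain of prime ideals `J`, going up. A prime ideal that omits
`a \ e` can be enlarged to one that contains `e` and still omits `a`. Iterating this, a family of
elements `e i` such that `J` omits the iterated boundaries of all its finite increasing subfamilies
gives finite chains of every length, and limits along an ultrafilter turn these into a chain indexed
by all `i`.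

If the `z`-filter is not minimal, `J` omits some boundary `N`, which is nowhere dense. Fattening `N`
repeatedly gives nowhere dense closed sets, each in the closure of what the next one adds to it. The
shells at distance about `4⁻ᵏ` from `N` are pairwise disjoint and accumulate at `N`, so the number
of fattenings can be prescribed separately on each of them. Continuum many functions `k ↦ c k` that
take any finitely many prescribed values simultaneously, for infinitely many `k`, thus give closed
sets whose finite iterated boundaries all contain `N`, hence are omitted by `J`.
-/

namespace PrimeZ

open Order Set Filter Topology TopologicalSpace Metric
open scoped Heyting Cardinal Function

section PrimeIdealChains

/-- The limit of a family of ideals along an ultrafilter. -/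
def ultralimit {ι L : Type*} [SemilatticeSup L] [OrderBot L] (𝔘 : Ultrafilter ι)
    (Q : ι → Ideal L) : Ideal L where
  carrier := {a | ∀ᶠ s in 𝔘, a ∈ Q s}
  lower' _ _ hba ha := ha.mono fun s => (Q s).lower hba
  nonempty' := ⟨⊥, Eventually.of_forall fun s => (Q s).bot_mem⟩
  directed' a ha b hb :=
    ⟨a ⊔ b, ha.mp (hb.mono fun _ hb ha => Ideal.sup_mem ha hb), le_sup_left, le_sup_right⟩

theorem mem_ultralimit {ι L : Type*} [SemilatticeSup L] [OrderBot L] {𝔘 : Ultrafilter ι}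
    {Q : ι → Ideal L} {a : L} : a ∈ ultralimit 𝔘 Q ↔ ∀ᶠ s in 𝔘, a ∈ Q s :=
  Iff.rfl

theorem isPrime_ultralimit {ι L : Type*} [Lattice L] [BoundedOrder L] (𝔘 : Ultrafilter ι)
    {Q : ι → Ideal L} (hQ : ∀ s, (Q s).IsPrime) : (ultralimit 𝔘 Q).IsPrime := by
  have : (ultralimit 𝔘 Q).IsProper := Ideal.isProper_of_notMem (p := ⊤) fun h =>
    let ⟨s, hs⟩ := (mem_ultralimit.1 h).exists
    (hQ s).toIsProper.top_notMem hs
  refine .of_mem_or_mem fun {a b} hab => ?_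
  simp only [mem_ultralimit, ← Ultrafilter.eventually_or] at hab ⊢
  exact hab.mono fun s => (hQ s).mem_or_mem

theorem exists_isPrime_of_sdiff_notMem {L : Type*} [GeneralizedCoheytingAlgebra L] {J : Ideal L}
    {a e : L} (h : a \ e ∉ J) : ∃ R : Ideal L, R.IsPrime ∧ J ≤ R ∧ e ∈ R ∧ a ∉ R := by
  have hdisj : Disjoint (PFilter.principal a : Set L) (J ⊔ Ideal.principal e : Ideal L) := by
    rw [Set.disjoint_left]
    intro b hab hb
    obtain ⟨w, hw, hbw⟩ := (Lattice.mem_ideal_sup_principal e b J).1 hb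
    exact h (J.lower (sdiff_le_iff'.2 (hab.trans hbw)) hw)
  obtain ⟨R, hR, hJR, hRa⟩ := DistribLattice.prime_ideal_of_disjoint_filter_ideal hdisj
  exact ⟨R, hR, le_sup_left.trans hJR,
    hJR (le_sup_right (a := J) Ideal.mem_principal_self), disjoint_left.1 hRa le_rfl⟩

variable {L I : Type*} [CoheytingAlgebra L] [LinearOrder I] {J : Ideal L}

/-- The co-Heyting boundary `∂ e = e ⊓ ￢e`, iterated along a list. A prime ideal that omits it can
be enlarged step by step to prime ideals that take up the elements of the list one at a time. -/
def iterBoundary : List L → L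
  | [] => ⊤
  | e :: l => e ⊓ (iterBoundary l \ e)

theorem exists_monotone_isPrime (e : I → L) {l : List I} (hl : l.Pairwise (· < ·))
    (hJ : J.IsPrime) (h : iterBoundary (l.map e) ∉ J) :
    ∃ Q : I → Ideal L, Monotone Q ∧ (∀ i, (Q i).IsPrime) ∧ (∀ i, J ≤ Q i) ∧
      (∀ i, (∀ j ∈ l, i ≤ j) → Q i = J) ∧ ∀ i ∈ l, ∀ j, e i ∈ Q j ↔ i < j := by
  induction l generalizing J with
  | nil => exact ⟨fun _ => J, monotone_const, fun _ => hJ, fun _ => le_rfl, by simp, by simp⟩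
  | cons a l ih =>
    obtain ⟨hal, hl⟩ := List.pairwise_cons.1 hl
    have haJ : e a ∉ J := fun ha => h (J.lower inf_le_left ha)
    obtain ⟨R, hR, hJR, haR, hlR⟩ :=
      exists_isPrime_of_sdiff_notMem fun ha => h (J.lower inf_le_right ha)
    obtain ⟨Q, hQmono, hQ, hRQ, -, hQe⟩ := ih hl hR hlR
    have hJQ (i : I) : J ≤ Q i := hJR.trans (hRQ i)
    refine ⟨fun i => if i ≤ a then J else Q i, fun i j hij => ?_, fun i => ?_, fun i => ?_,
      fun i hi => if_pos (hi a List.mem_cons_self), fun i hi j => ?_⟩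
    · dsimp only
      split_ifs with hi hj hj
      exacts [le_rfl, hJQ j, absurd (hij.trans hj) hi, hQmono hij]
    · dsimp only
      split_ifs
      exacts [hJ, hQ i]
    · dsimp only
      split_ifs
      exacts [le_rfl, hJQ i]
    · dsimp only
      rcases List.mem_cons.1 hi with rfl | hi
      · split_ifs with hj
        exacts [iff_of_false haJ hj.not_gt, iff_of_true (hRQ j haR) (not_le.1 hj)]
      · split_ifs with hj
        · have hiJ : e i ∉ J := fun hiJ => lt_irrefl i ((hQe i hi i).1 (hJQ i hiJ))
          exact iff_of_false hiJ (hj.trans_lt (hal i hi)).not_gt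
        · exact hQe i hi j

theorem exists_strictMono_isPrime (e : I → L) (hJ : J.IsPrime)
    (h : ∀ l : List I, l.Pairwise (· < ·) → iterBoundary (l.map e) ∉ J) :
    ∃ Q : I → Ideal L, StrictMono Q ∧ (∀ i, (Q i).IsPrime) ∧ ∀ i, IsMin i → Q i = J := by
  have hsort (s : Finset I) : s.sort.Pairwise (· < ·) := s.sortedLT_sort.pairwise
  choose Q hQmono hQ _ hQmin hQe using fun s : Finset I =>
    exists_monotone_isPrime e (hsort s) hJ (h _ (hsort s))
  let 𝔘 : Ultrafilter (Finset I) := Ultrafilter.of atTop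
  have mem_ultralimit_iff (i j : I) : e i ∈ ultralimit 𝔘 (Q · j) ↔ i < j := by
    have hi : ∀ᶠ s in (𝔘 : Filter (Finset I)), (e i ∈ Q s j ↔ i < j) :=
      Ultrafilter.of_le _ <| (eventually_ge_atTop {i}).mono fun s hs =>
        hQe s i ((Finset.mem_sort _).2 (Finset.singleton_subset_iff.1 hs)) j
    rw [mem_ultralimit, eventually_congr hi, eventually_const]
  refine ⟨fun i => ultralimit 𝔘 (Q · i), fun i j hij => ?_,
    fun i => isPrime_ultralimit 𝔘 fun s => hQ s i, fun i hi => ?_⟩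
  · refine SetLike.lt_iff_le_and_exists.2 ⟨fun a ha => ?_, e i, ?_, ?_⟩
    · exact (mem_ultralimit.1 ha).mono fun s => @hQmono s i j hij.le a
    · exact (mem_ultralimit_iff i j).2 hij
    · exact fun hmem => lt_irrefl i ((mem_ultralimit_iff i i).1 hmem)
  · have hQi (s : Finset I) : Q s i = J := hQmin s i fun j _ => (le_total i j).elim id (hi ·)
    ext a
    simp [mem_ultralimit, hQi]

end PrimeIdealChains

section ClosedSets

variable {X : Type*} [TopologicalSpace X]

theorem closeds_coe_sdiff (C D : Closeds X) : ((C \ D : Closeds X) : Set X) = closure (C \ D) := by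
  have : C \ D = Closeds.closure (C \ D : Set X) := eq_of_forall_ge_iff fun W => by
    rw [sdiff_le_iff, Closeds.closure_le, sdiff_subset_iff, ← Closeds.coe_sup,
      SetLike.coe_subset_coe]
  rw [this, Closeds.coe_closure]

theorem closeds_coe_hnot (C : Closeds X) : ((￢C : Closeds X) : Set X) = closure (C : Set X)ᶜ := by
  rw [← top_sdiff', closeds_coe_sdiff, Closeds.coe_top, ← compl_eq_univ_sdiff]

theorem dense_compl_boundary (C : Closeds X) : Dense ((∂ C : Closeds X) : Set X)ᶜ := by
  rw [dense_iff_closure_eq, ← closeds_coe_hnot, Coheyting.hnot_boundary, Closeds.coe_top]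

theorem inter_subset_iterBoundary {U : Set X} (hU : IsOpen U) {T : ℕ → Closeds X}
    (hT : ∀ j, T j ≤ T (j + 1) \ T j) (l : List (Closeds X)) (j : ℕ)
    (hl : ∀ i (hi : i < l.length), (l[i] : Set X) ∩ U = ↑(T (j + i)) ∩ U) :
    U ∩ T j ⊆ (iterBoundary l : Closeds X) := by
  induction l generalizing j with
  | nil => exact subset_univ _
  | cons C l ih =>
    have hC : (C : Set X) ∩ U = ↑(T j) ∩ U := hl 0 (by simp)
    have hl' : U ∩ T (j + 1) ⊆ (iterBoundary l : Closeds X) := ih (j + 1) fun i hi => by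
      rw [add_assoc, add_comm 1 i]
      exact hl (i + 1) (Nat.succ_lt_succ hi)
    rw [iterBoundary, Closeds.coe_inf, closeds_coe_sdiff]
    rintro x ⟨hxU, hxT⟩
    refine ⟨(hC.ge ⟨hxT, hxU⟩).1, ?_⟩
    have hx : x ∈ closure (T (j + 1) \ T j : Set X) := closeds_coe_sdiff _ (T j) ▸ hT j hxT
    refine closure_mono ?_ (hU.inter_closure ⟨hxU, hx⟩)
    rintro y ⟨hyU, hyT, hyT'⟩
    exact ⟨hl' ⟨hyU, hyT⟩, fun hyC => hyT' (hC.le ⟨hyC, hyU⟩).1⟩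

end ClosedSets

section Fattening

variable {X : Type*} [PseudoMetricSpace X]

theorem isClosed_union_iUnion_of_subset_cthickening {N : Set X} (hN : IsClosed N)
    {F : ℕ → Set X} (hF : ∀ k, IsClosed (F k)) {ε : ℕ → ℝ} (hε : Tendsto ε atTop (𝓝 0))
    (hFε : ∀ k, F k ⊆ cthickening (ε k) N) : IsClosed (N ∪ ⋃ k, F k) := by
  refine isClosed_of_closure_subset fun x hx => or_iff_not_imp_left.2 fun hxN => ?_
  obtain ⟨δ, hδ, hxδ⟩ : ∃ δ > 0, x ∉ cthickening δ N := by
    rw [← hN.closure_eq, closure_eq_iInter_cthickening] at hxN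
    simpa using hxN
  obtain ⟨n, hn⟩ := eventually_atTop.1 (hε.eventually_le_const hδ)
  have hsub : N ∪ ⋃ k, F k ⊆ (⋃ k ∈ Iio n, F k) ∪ cthickening δ N := by
    refine union_subset ((self_subset_cthickening N).trans subset_union_right)
      (iUnion_subset fun k => ?_)
    rcases lt_or_ge k n with hk | hk
    · exact (subset_biUnion_of_mem (mem_Iio.2 hk)).trans subset_union_left
    · exact ((hFε k).trans (cthickening_mono (hn k hk) N)).trans subset_union_right
  have hclosed : IsClosed ((⋃ k ∈ Iio n, F k) ∪ cthickening δ N) :=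
    ((finite_Iio n).isClosed_biUnion fun k _ => hF k).union isClosed_cthickening
  have hxF := (closure_minimal hsub hclosed hx).resolve_right hxδ
  exact iUnion₂_subset_iUnion _ _ hxF

/-- The distances `4⁻ᵏ`, together with their limit `0`. -/
def scale : Set ℝ :=
  insert 0 (range fun k : ℕ => (1 / 4 : ℝ) ^ k)

theorem countable_scale : scale.Countable :=
  (countable_range _).insert 0

theorem isClosed_scale : IsClosed scale :=
  (tendsto_pow_atTop_nhds_zero_of_lt_one (by norm_num)
    (by norm_num)).isCompact_insert_range.isClosed

/-- The points whose distance to `M` is `0` or some `4⁻ᵏ`: a closed set that surrounds `M` by thin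
layers accumulating at each of its points. -/
def fatten (M : Closeds X) : Closeds X :=
  ⟨{x | infDist x M ∈ scale}, isClosed_scale.preimage (continuous_infDist_pt _)⟩

theorem le_fatten (M : Closeds X) : M ≤ fatten M := fun _ hx =>
  Or.inl (infDist_zero_of_mem hx)

/-- A closed neighbourhood of the set of points at distance `4⁻ᵏ` from `N`. -/
def shell (N : Set X) (k : ℕ) : Set X :=
  {x | infDist x N ∈ Icc ((1 / 4) ^ k / 2) (3 / 2 * (1 / 4) ^ k)}

theorem isClosed_shell (N : Set X) (k : ℕ) : IsClosed (shell N k) :=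
  isClosed_Icc.preimage (continuous_infDist_pt N)

theorem mem_interior_shell {N : Set X} {k : ℕ} {x : X} (hx : infDist x N = (1 / 4) ^ k) :
    x ∈ interior (shell N k) := by
  have hpos : (0 : ℝ) < (1 / 4) ^ k := by positivity
  refine preimage_interior_subset_interior_preimage (continuous_infDist_pt N) ?_
  rw [mem_preimage, interior_Icc, hx]
  constructor <;> linarith

theorem infDist_pos_of_mem_shell {N : Set X} {k : ℕ} {x : X} (hx : x ∈ shell N k) :
    0 < infDist x N :=
  (by positivity : (0 : ℝ) < (1 / 4) ^ k / 2).trans_le hx.1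

theorem disjoint_shell (N : Set X) (k : ℕ) : Disjoint N (shell N k) :=
  disjoint_left.2 fun _ hxN hx => (infDist_pos_of_mem_shell hx).ne' (infDist_zero_of_mem hxN)

theorem pairwise_disjoint_shell (N : Set X) : Pairwise (Disjoint on shell N) := by
  refine (pairwise_disjoint_on _).2 fun a b hab => disjoint_left.2 fun x ha hb => ?_
  have hpow : (1 / 4 : ℝ) ^ b ≤ (1 / 4) ^ a * (1 / 4) := by
    rw [← pow_succ]
    exact pow_le_pow_of_le_one (by norm_num) (by norm_num) hab
  have hpos : (0 : ℝ) < (1 / 4) ^ a := by positivity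
  linarith [ha.1, hb.2]

theorem shell_subset_cthickening (N : Set X) (k : ℕ) :
    shell N k ⊆ cthickening (3 / 2 * (1 / 4) ^ k) N := fun x hx => by
  have hfin : infEDist x N ≠ ⊤ := fun h => by
    simpa [infDist, h] using infDist_pos_of_mem_shell hx
  exact (ENNReal.le_ofReal_iff_toReal_le hfin (by positivity)).2 hx.2

/-- The closed set that agrees, near distance `4⁻ᵏ` from `N`, with the `(c k + 1)`-fold fattening
of `N`. -/
def fattenAlong (N : Closeds X) (c : ℕ → ℕ) : Closeds X where
  carrier := N ∪ ⋃ k, shell N k ∩ fatten^[c k + 1] N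
  isClosed' := by
    refine isClosed_union_iUnion_of_subset_cthickening N.isClosed
      (fun k => (isClosed_shell _ k).inter (Closeds.isClosed _)) ?_
      fun k => inter_subset_left.trans (shell_subset_cthickening _ k)
    simpa using (tendsto_pow_atTop_nhds_zero_of_lt_one (r := (1 / 4 : ℝ)) (by norm_num)
      (by norm_num)).const_mul (3 / 2)

theorem fattenAlong_inter_shell (N : Closeds X) (c : ℕ → ℕ) (k : ℕ) :
    (fattenAlong N c : Set X) ∩ shell N k = ↑(fatten^[c k + 1] N) ∩ shell N k := by
  ext x
  refine and_congr_left fun hx => ⟨?_, fun h => Or.inr (mem_iUnion.2 ⟨k, hx, h⟩)⟩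
  rintro (hxN | hx')
  · exact absurd hx (disjoint_left.1 (disjoint_shell _ k) hxN)
  · obtain ⟨m, hxm, hm⟩ := mem_iUnion.1 hx'
    obtain rfl : m = k := (pairwise_disjoint_shell (N : Set X)).eq (not_disjoint_iff.2 ⟨x, hxm, hx⟩)
    exact hm

end Fattening

section NormedSpace

variable {E : Type*} [NormedAddCommGroup E] [NormedSpace ℝ E]

theorem image_infDist_mem_nhdsGE {M U : Set E} (hM : IsClosed M) (hd : Dense Mᶜ) {p : E}
    (hp : p ∈ M) (hU : U ∈ 𝓝 p) : (infDist · M) '' U ∈ 𝓝[≥] (0 : ℝ) := by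
  obtain ⟨r, hr, hrU⟩ := Metric.mem_nhds_iff.1 hU
  obtain ⟨y, hyM, hyr⟩ := hd.exists_mem_open isOpen_ball ⟨p, mem_ball_self hr⟩
  have hy : 0 < infDist y M := (hM.notMem_iff_infDist_pos ⟨p, hp⟩).1 hyM
  have hsub : Icc (infDist p M) (infDist y M) ⊆ (infDist · M) '' ball p r :=
    isPreconnected_ball.intermediate_value (mem_ball_self hr) hyr
      (continuous_infDist_pt M).continuousOn
  rw [infDist_zero_of_mem hp] at hsub
  exact mem_of_superset (Icc_mem_nhdsGE hy) (hsub.trans (image_mono hrU))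

theorem subset_closure_infDist_eq_pow {M : Set E} (hM : IsClosed M) (hd : Dense Mᶜ) {K : Set ℕ}
    (hK : K.Infinite) : M ⊆ closure {x | ∃ k ∈ K, infDist x M = (1 / 4) ^ k} := by
  intro p hp
  refine mem_closure_iff_nhds.2 fun U hU => ?_
  have hpow : Tendsto (fun k : ℕ => (1 / 4 : ℝ) ^ k) atTop (𝓝[≥] 0) :=
    (tendsto_pow_atTop_nhdsWithin_zero_of_lt_one (by norm_num) (by norm_num)).mono_right
      (nhdsWithin_mono _ Ioi_subset_Ici_self)
  obtain ⟨k, hkK, x, hxU, hx⟩ := ((Nat.frequently_atTop_iff_infinite.2 hK).and_eventually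
    (hpow (image_infDist_mem_nhdsGE hM hd hp hU))).exists
  exact ⟨x, hxU, k, hkK, hx⟩

theorem exists_mem_ball_infDist_lt {M : Set E} {x : E} (hx : 0 < infDist x M) {ε : ℝ}
    (hε : 0 < ε) : ∃ y ∈ ball x ε, infDist y M < infDist x M := by
  have hM : M.Nonempty := nonempty_iff_ne_empty.2 fun h => by simp [h] at hx
  set c := infDist x M
  obtain ⟨q, hqM, hq⟩ := (infDist_lt_iff hM).1 (lt_add_of_pos_right c hε)
  set t := ε / (c + ε)
  have ht : 0 < t := by positivity
  have ht' : 1 - t = c / (c + ε) := by simp only [t]; field_simp; ring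
  refine ⟨AffineMap.lineMap x q t, ?_, (infDist_le_dist_of_mem hqM).trans_lt ?_⟩
  · rw [mem_ball, dist_lineMap_left, Real.norm_of_nonneg ht.le]
    exact (mul_lt_mul_of_pos_left hq ht).trans_eq (div_mul_cancel₀ ε (by positivity))
  · rw [dist_lineMap_right, ht', Real.norm_of_nonneg (by positivity)]
    exact (mul_lt_mul_of_pos_left hq (by positivity)).trans_eq
      (div_mul_cancel₀ c (by positivity))

theorem dense_infDist_notMem {M : Set E} (hM : IsClosed M) (hne : M.Nonempty) (hd : Dense Mᶜ)
    {S : Set ℝ} (hS : S.Countable) : Dense {x | infDist x M ∉ S} := by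
  refine Metric.dense_iff.2 fun p r hr => not_disjoint_iff_nonempty_inter.1 fun hdisj => ?_
  have hsub : (infDist · M) '' ball p r ⊆ S := image_subset_iff.2 fun x hx =>
    not_not.1 (disjoint_left.1 hdisj hx)
  have hconst : ((infDist · M) '' ball p r).Subsingleton := hS.isTotallyDisconnected _ hsub <|
    isPreconnected_ball.image _ (continuous_infDist_pt M).continuousOn
  obtain ⟨x, hxM, hxr⟩ := hd.exists_mem_open isOpen_ball ⟨p, mem_ball_self hr⟩
  obtain ⟨ε, hε, hεr⟩ := Metric.isOpen_iff.1 isOpen_ball x hxr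
  obtain ⟨y, hy, hyx⟩ := exists_mem_ball_infDist_lt ((hM.notMem_iff_infDist_pos hne).1 hxM) hε
  exact hyx.ne (hconst (mem_image_of_mem _ (hεr hy)) (mem_image_of_mem _ hxr))

theorem le_fatten_sdiff {M : Closeds E} (hd : Dense (M : Set E)ᶜ) : M ≤ fatten M \ M := by
  rw [← SetLike.coe_subset_coe, closeds_coe_sdiff]
  refine (subset_closure_infDist_eq_pow M.isClosed hd infinite_univ).trans (closure_mono ?_)
  rintro x ⟨k, -, hk⟩
  refine ⟨Or.inr ⟨k, hk.symm⟩, fun hx => ?_⟩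
  rw [infDist_zero_of_mem hx] at hk
  exact (pow_pos (by norm_num) k).ne hk

theorem dense_compl_fatten {M : Closeds E} (hne : (M : Set E).Nonempty)
    (hd : Dense (M : Set E)ᶜ) : Dense (fatten M : Set E)ᶜ :=
  dense_infDist_notMem M.isClosed hne hd countable_scale

theorem nonempty_and_dense_compl_fatten_iterate {N : Closeds E} (hne : (N : Set E).Nonempty)
    (hd : Dense (N : Set E)ᶜ) (j : ℕ) :
    (fatten^[j] N : Set E).Nonempty ∧ Dense (fatten^[j] N : Set E)ᶜ := by
  induction j with
  | zero => exact ⟨hne, hd⟩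
  | succ j ih =>
    rw [Function.iterate_succ_apply']
    exact ⟨ih.1.mono (le_fatten _), dense_compl_fatten ih.1 ih.2⟩

theorem le_iterBoundary_map_fattenAlong {N : Closeds E} (hne : (N : Set E).Nonempty)
    (hd : Dense (N : Set E)ᶜ) {l : List (ℕ → ℕ)} {K : Set ℕ} (hK : K.Infinite)
    (hl : ∀ k ∈ K, ∀ i (hi : i < l.length), l[i] k = i) :
    N ≤ iterBoundary (l.map (fattenAlong N)) := by
  let U : Set E := ⋃ k ∈ K, interior (shell N k)
  have hU : IsOpen U := isOpen_biUnion fun _ _ => isOpen_interior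
  have hT (j : ℕ) : fatten^[j + 1] N ≤ fatten^[j + 1 + 1] N \ fatten^[j + 1] N := by
    rw [Function.iterate_succ_apply' _ (j + 1)]
    exact le_fatten_sdiff (nonempty_and_dense_compl_fatten_iterate hne hd (j + 1)).2
  have hUT : U ∩ fatten N ⊆ (iterBoundary (l.map (fattenAlong N)) : Closeds E) := by
    refine inter_subset_iterBoundary hU (T := fun j => fatten^[j + 1] N) hT _ 0 fun i hi => ?_
    rw [List.length_map] at hi
    rw [List.getElem_map, zero_add]
    ext x
    refine and_congr_left fun hx => ?_
    obtain ⟨k, hk, hxk⟩ := mem_iUnion₂.1 hx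
    have hx' := Set.ext_iff.1 (fattenAlong_inter_shell N l[i] k) x
    rw [hl k hk i hi] at hx'
    exact and_congr_left_iff.1 hx' (interior_subset hxk)
  refine (subset_closure_infDist_eq_pow N.isClosed hd hK).trans
    (closure_minimal ?_ (Closeds.isClosed _))
  rintro x ⟨k, hk, hx⟩
  exact hUT ⟨mem_biUnion hk (mem_interior_shell hx), Or.inr ⟨k, hx.symm⟩⟩

end NormedSpace

section PrimeIdealsOfClosedSets

/-- The place of the `m`-th initial segment of `r` in a finite list of finite sequences, where `k`
encodes `m` and the list. Finitely many different `r` have different initial segments of every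
sufficiently large length `m`, so the functions `indep r` take any prescribed positions
simultaneously. -/
def indep (r : ℕ → ℕ) (k : ℕ) : ℕ :=
  let p := Denumerable.ofNat (ℕ × List (List ℕ)) k
  p.2.idxOf (PiNat.res r p.1)

theorem eventually_injOn_res {S : Set (ℕ → ℕ)} (hS : S.Finite) :
    ∀ᶠ m in atTop, InjOn (PiNat.res · m) S := by
  refine (eventually_all_finite hS).2 fun r _ => (eventually_all_finite hS).2 fun r' _ => ?_
  rcases eq_or_ne r r' with rfl | hr
  · exact Eventually.of_forall fun _ _ => rfl
  obtain ⟨n, hn⟩ := Function.ne_iff.1 hr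
  filter_upwards [eventually_gt_atTop n] with m hm h
  exact absurd (PiNat.res_eq_res.1 h hm) hn

theorem infinite_indep_eq {l : List (ℕ → ℕ)} (hl : l.Nodup) :
    {k | ∀ i (h : i < l.length), indep l[i] k = i}.Infinite := by
  obtain ⟨n, hn⟩ := eventually_atTop.1 (eventually_injOn_res l.finite_toSet)
  let code (m : ℕ) : ℕ := Encodable.encode (m, l.map (PiNat.res · m))
  have hcode : Function.Injective code := fun m m' h =>
    congrArg Prod.fst (Encodable.encode_injective h)
  refine ((Ici_infinite n).image hcode.injOn).mono ?_
  rintro _ ⟨m, hm, rfl⟩ i hi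
  have hnd : (l.map (PiNat.res · m)).Nodup := hl.map_on fun r hr r' hr' h => hn m hm hr hr' h
  have := hnd.idxOf_getElem i (by simpa using hi)
  simpa [indep, code] using this

theorem exists_strictMono_isPrime_closeds {E I : Type*} [NormedAddCommGroup E] [NormedSpace ℝ E]
    [LinearOrder I] (hI : #I ≤ 𝔠) {J : Ideal (Closeds E)} (hJ : J.IsPrime) {C : Closeds E}
    (hC : ∂ C ∉ J) :
    ∃ Q : I → Ideal (Closeds E), StrictMono Q ∧ (∀ i, (Q i).IsPrime) ∧ ∀ i, IsMin i → Q i = J := by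
  obtain ⟨ι⟩ : Nonempty (I ↪ (ℕ → ℕ)) := Cardinal.lift_mk_le'.1 (by simpa using hI)
  have hne : ((∂ C : Closeds E) : Set E).Nonempty := nonempty_iff_ne_empty.2 fun h =>
    hC (by rw [SetLike.coe_injective (h.trans Closeds.coe_bot.symm)]; exact J.bot_mem)
  refine exists_strictMono_isPrime (fun i => fattenAlong (∂ C) (indep (ι i))) hJ
    fun l hl hmem => hC (J.lower ?_ hmem)
  have hnd : (l.map ι).Nodup := List.Nodup.map ι.injective (hl.imp ne_of_lt)
  have hle := le_iterBoundary_map_fattenAlong (l := (l.map ι).map indep) hne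
    (dense_compl_boundary C) (infinite_indep_eq hnd) fun k hk i hi => by
      rw [List.getElem_map]
      exact hk i (by simpa using hi)
  simpa [List.map_map, Function.comp_def] using hle

end PrimeIdealsOfClosedSets

section ZFilters

variable {X : Type*} [TopologicalSpace X]

/-- The closed sets outside of the ideal `J`. On a perfectly normal space the zero sets are exactly
the closed sets, and the prime `z`-filters are exactly the `zFilterOf J` with `J` prime. -/
def zFilterOf (J : Ideal (Closeds X)) : Set (Set X) :=
  (↑) '' (J : Set (Closeds X))ᶜ

theorem coe_mem_zFilterOf {J : Ideal (Closeds X)} {C : Closeds X} :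
    (C : Set X) ∈ zFilterOf J ↔ C ∉ J :=
  SetLike.coe_injective.mem_set_image

theorem strictAnti_zFilterOf : StrictAnti (zFilterOf : Ideal (Closeds X) → Set (Set X)) :=
  fun _ _ h => SetLike.coe_injective.image_strictMono (compl_lt_compl_iff_lt.2 h)

variable [PerfectlyNormalSpace X]

theorem mem_zeroSets_iff {Z : Set X} : Z ∈ zeroSets X ↔ IsClosed Z := by
  constructor
  · rintro ⟨f, rfl⟩
    exact isClosed_eq f.continuous continuous_const
  · intro hZ
    obtain ⟨f, hf, -⟩ := perfectlyNormalSpace_iff_forall_isClosed_preimage_zero.1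
      inferInstance Z hZ
    exact ⟨f, hf⟩

theorem isPrimeZFilter_zFilterOf {J : Ideal (Closeds X)} (hJ : J.IsPrime) :
    IsPrimeZFilter (zFilterOf J) where
  isZFilter.nonempty := ⟨_, coe_mem_zFilterOf.2 hJ.toIsProper.top_notMem⟩
  isZFilter.ssubset := by
    refine ⟨image_subset_iff.2 fun C _ => mem_zeroSets_iff.2 C.isClosed, fun h => ?_⟩
    exact coe_mem_zFilterOf.1 (h (mem_zeroSets_iff.2 (⊥ : Closeds X).isClosed)) J.bot_mem
  isZFilter.inter_mem := by
    rintro _ ⟨C, hC, rfl⟩ _ ⟨D, hD, rfl⟩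
    exact ⟨C ⊓ D, fun h => (hJ.mem_or_mem h).elim hC hD, Closeds.coe_inf C D⟩
  isZFilter.superset_mem := by
    rintro _ ⟨C, hC, rfl⟩ W hW hCW
    exact ⟨⟨W, mem_zeroSets_iff.1 hW⟩, fun h => hC (J.lower hCW h), rfl⟩
  union_notMem Z hZ W hW := by
    lift Z to Closeds X using mem_zeroSets_iff.1 hZ
    lift W to Closeds X using mem_zeroSets_iff.1 hW
    simp only [← Closeds.coe_sup, coe_mem_zFilterOf, not_not]
    exact Ideal.sup_mem

theorem IsPrimeZFilter.exists_isPrime_zFilterOf_eq {P : Set (Set X)} (hP : IsPrimeZFilter P) :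
    ∃ J : Ideal (Closeds X), J.IsPrime ∧ zFilterOf J = P := by
  have hF := hP.isZFilter
  obtain ⟨Z, hZ⟩ := hF.nonempty
  have hzero (C : Closeds X) : (C : Set X) ∈ zeroSets X := mem_zeroSets_iff.2 C.isClosed
  let J : Ideal (Closeds X) :=
    { carrier := {C | (C : Set X) ∉ P}
      lower' := fun C D hDC hC hD => hC (hF.superset_mem _ hD _ (hzero C) hDC)
      nonempty' := ⟨⊥, fun h => hF.ssubset.2 fun W hW => hF.superset_mem _ h W hW (empty_subset W)⟩
      directed' := fun C hC D hD =>
        ⟨C ⊔ D, hP.union_notMem _ (hzero C) _ (hzero D) hC hD, le_sup_left, le_sup_right⟩ }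
  have : J.IsProper := Ideal.isProper_of_notMem (p := ⊤) fun h =>
    h (hF.superset_mem Z hZ _ (hzero ⊤) (subset_univ Z))
  refine ⟨J, .of_mem_or_mem fun {C D} hCD => ?_, ?_⟩
  · by_contra! h
    exact hCD (hF.inter_mem _ (not_not.1 h.1) _ (not_not.1 h.2))
  · ext W
    constructor
    · rintro ⟨C, hC, rfl⟩
      exact not_not.1 hC
    · exact fun hW => ⟨⟨W, mem_zeroSets_iff.1 (hF.ssubset.1 hW)⟩, not_not.2 hW, rfl⟩

theorem IsPrimeZFilter.exists_closure_compl_mem {P P' : Set (Set X)} (hP' : IsPrimeZFilter P')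
    (h : P' ⊂ P) (hP : P ⊆ zeroSets X) : ∃ Z ∈ P, closure Zᶜ ∈ P := by
  obtain ⟨Z, hZ, hZ'⟩ := exists_of_ssubset h
  refine ⟨Z, hZ, h.1 (by_contra fun hcl => ?_)⟩
  obtain ⟨W, hW⟩ := hP'.isZFilter.nonempty
  have huniv : Z ∪ closure Zᶜ = univ :=
    univ_subset_iff.1 ((union_compl_self Z).ge.trans (union_subset_union_right Z subset_closure))
  refine hP'.union_notMem Z (hP hZ) _ (mem_zeroSets_iff.2 isClosed_closure) hZ' hcl ?_
  rw [huniv]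
  exact hP'.isZFilter.superset_mem W hW _ (mem_zeroSets_iff.2 isClosed_univ) (subset_univ W)

theorem IsPrimeZFilter.exists_strictAnti {E I : Type*} [NormedAddCommGroup E] [NormedSpace ℝ E]
    [LinearOrder I] (hI : #I ≤ 𝔠) {P : Set (Set E)} (hP : IsPrimeZFilter P) {Z : Set E}
    (hZ : Z ∈ P) (hZ' : closure Zᶜ ∈ P) :
    ∃ Q : I → Set (Set E), StrictAnti Q ∧ (∀ i, IsPrimeZFilter (Q i)) ∧ ∀ i, IsMin i → Q i = P := by
  obtain ⟨J, hJ, rfl⟩ := hP.exists_isPrime_zFilterOf_eq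
  lift Z to Closeds E using mem_zeroSets_iff.1 (hP.isZFilter.ssubset.1 hZ)
  have hC : ∂ Z ∉ J := by
    rw [← coe_mem_zFilterOf, Coheyting.boundary, Closeds.coe_inf, closeds_coe_hnot]
    exact hP.isZFilter.inter_mem _ hZ _ hZ'
  obtain ⟨Q, hQmono, hQ, hQmin⟩ := exists_strictMono_isPrime_closeds hI hJ hC
  exact ⟨zFilterOf ∘ Q, strictAnti_zFilterOf.comp_strictMono hQmono,
    fun i => isPrimeZFilter_zFilterOf (hQ i), fun i hi => congrArg zFilterOf (hQmin i hi)⟩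

end ZFilters

section FunctionIdeals

variable {X 𝕜 : Type*} [RCLike 𝕜]

section TopologicalSpace

variable [TopologicalSpace X]

theorem setOf_eq_zero_mem_zeroSets (f : C₀(X, 𝕜)) : {x | f x = 0} ∈ zeroSets X :=
  ⟨⟨fun x => ‖f x‖, (map_continuous f).norm⟩, by simp⟩

theorem setOf_mul_eq_zero (f g : C₀(X, 𝕜)) :
    {x | (f * g) x = 0} = {x | f x = 0} ∪ {x | g x = 0} := by
  ext x
  simp

/-- The ideal of the functions whose zero sets belong to the `z`-filter `F`. -/
def functionIdeal (𝕜 : Type*) [RCLike 𝕜] {F : Set (Set X)} (hF : IsZFilter F) :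
    TwoSidedIdeal C₀(X, 𝕜) :=
  .mk' {f | {x | f x = 0} ∈ F}
    (by
      obtain ⟨Z, hZ⟩ := hF.nonempty
      exact hF.superset_mem Z hZ _ (setOf_eq_zero_mem_zeroSets 0) fun _ _ => rfl)
    (fun {f g} hf hg => hF.superset_mem _ (hF.inter_mem _ hf _ hg) _
      (setOf_eq_zero_mem_zeroSets (f + g)) fun x hx => by
        simp [mem_ofPred.1 hx.1, mem_ofPred.1 hx.2])
    (fun hf => by simpa using hf)
    (fun {f g} hg => hF.superset_mem _ hg _ (setOf_eq_zero_mem_zeroSets (f * g)) <|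
      subset_union_right.trans_eq (setOf_mul_eq_zero f g).symm)
    (fun {f g} hf => hF.superset_mem _ hf _ (setOf_eq_zero_mem_zeroSets (f * g)) <|
      subset_union_left.trans_eq (setOf_mul_eq_zero f g).symm)

theorem mem_functionIdeal {F : Set (Set X)} {hF : IsZFilter F} {f : C₀(X, 𝕜)} :
    f ∈ functionIdeal 𝕜 hF ↔ {x | f x = 0} ∈ F :=
  TwoSidedIdeal.mem_mk' _ _ _ _ _ _ _

theorem isZIdeal_functionIdeal {F : Set (Set X)} (hF : IsZFilter F) :
    IsZIdeal (functionIdeal 𝕜 hF) := fun _ hf g hfg =>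
  mem_functionIdeal.2 <|
    hF.superset_mem _ (mem_functionIdeal.1 hf) _ (setOf_eq_zero_mem_zeroSets g) hfg

/-- The zero sets of the functions of an ideal. -/
def zeroSetsOf (P : TwoSidedIdeal C₀(X, 𝕜)) : Set (Set X) :=
  {Z | ∃ f ∈ P, {x | f x = 0} = Z}

theorem setOf_eq_zero_mem_zeroSetsOf {P : TwoSidedIdeal C₀(X, 𝕜)} (hz : IsZIdeal P)
    {f : C₀(X, 𝕜)} : {x | f x = 0} ∈ zeroSetsOf P ↔ f ∈ P :=
  ⟨fun ⟨g, hg, hgf⟩ => hz g hg f hgf.le, fun hf => ⟨f, hf, rfl⟩⟩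

theorem functionIdeal_zeroSetsOf {P : TwoSidedIdeal C₀(X, 𝕜)} (hz : IsZIdeal P)
    (hF : IsZFilter (zeroSetsOf P)) : functionIdeal 𝕜 hF = P := by
  ext f
  rw [mem_functionIdeal, setOf_eq_zero_mem_zeroSetsOf hz]

theorem inter_mem_zeroSetsOf {P : TwoSidedIdeal C₀(X, 𝕜)} {Z W : Set X} (hZ : Z ∈ zeroSetsOf P)
    (hW : W ∈ zeroSetsOf P) : Z ∩ W ∈ zeroSetsOf P := by
  obtain ⟨f, hf, rfl⟩ := hZ
  obtain ⟨g, hg, rfl⟩ := hW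
  refine ⟨star f * f + star g * g, P.add_mem (P.mul_mem_left _ _ hf) (P.mul_mem_left _ _ hg), ?_⟩
  ext x
  have hsq : (star f * f + star g * g) x = ((‖f x‖ ^ 2 + ‖g x‖ ^ 2 : ℝ) : 𝕜) := by
    simp [RCLike.conj_mul]
  rw [mem_ofPred_eq, hsq, RCLike.ofReal_eq_zero,
    add_eq_zero_iff_of_nonneg (by positivity) (by positivity)]
  simp

end TopologicalSpace

variable [PseudoMetricSpace X] [ProperSpace X]

theorem exists_zeroAtInfty_setOf_eq_zero (𝕜 : Type*) [RCLike 𝕜] {Z : Set X} (hZ : IsClosed Z) :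
    ∃ f : C₀(X, 𝕜), {x | f x = 0} = Z := by
  cases isEmpty_or_nonempty X with
  | inl _ => exact ⟨0, Subsingleton.elim _ _⟩
  | inr h =>
    obtain ⟨x₀⟩ := h
    obtain ⟨φ, rfl, hφ⟩ := perfectlyNormalSpace_iff_forall_isClosed_preimage_zero.1
      inferInstance Z hZ
    have hpos (x : X) : 0 < 1 + dist x x₀ := by positivity
    let f (x : X) : ℝ := φ x * (1 + dist x x₀)⁻¹
    have hf : Continuous f := φ.continuous.mul <|
      (continuous_const.add (continuous_id.dist continuous_const)).inv₀ fun x => (hpos x).ne'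
    have hf₀ : Tendsto f (cocompact X) (𝓝 0) := by
      have hinv : Tendsto (fun x => (1 + dist x x₀)⁻¹) (cocompact X) (𝓝 0) :=
        (tendsto_atTop_add_const_left _ _ (tendsto_dist_right_cocompact_atTop x₀)).inv_tendsto_atTop
      exact squeeze_zero (fun x => mul_nonneg (hφ x).1 (inv_nonneg.2 (hpos x).le))
        (fun x => mul_le_of_le_one_left (inv_nonneg.2 (hpos x).le) (hφ x).2) hinv
    refine ⟨⟨⟨fun x => (f x : 𝕜), RCLike.continuous_ofReal.comp hf⟩, ?_⟩, ?_⟩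
    · exact (RCLike.continuous_ofReal.tendsto' 0 0 RCLike.ofReal_zero).comp hf₀
    · ext x
      change (f x : 𝕜) = 0 ↔ φ x = 0
      rw [RCLike.ofReal_eq_zero, mul_eq_zero, or_iff_left (inv_ne_zero (hpos x).ne')]

theorem isPrimeIdeal_functionIdeal {F : Set (Set X)} (hF : IsPrimeZFilter F) :
    IsPrimeIdeal (functionIdeal 𝕜 hF.isZFilter) where
  ne_top h := by
    refine hF.isZFilter.ssubset.2 fun Z hZ => ?_
    obtain ⟨f, rfl⟩ := exists_zeroAtInfty_setOf_eq_zero 𝕜 (mem_zeroSets_iff.1 hZ)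
    exact mem_functionIdeal.1 (h ▸ trivial : f ∈ functionIdeal 𝕜 hF.isZFilter)
  mem_or_mem f g h := by
    simp only [mem_functionIdeal, setOf_mul_eq_zero] at h ⊢
    by_contra! hfg
    exact hF.union_notMem _ (setOf_eq_zero_mem_zeroSets f) _ (setOf_eq_zero_mem_zeroSets g)
      hfg.1 hfg.2 h

theorem functionIdeal_lt_functionIdeal {F G : Set (Set X)} (hF : IsZFilter F) (hG : IsZFilter G)
    (h : F ⊂ G) : functionIdeal 𝕜 hF < functionIdeal 𝕜 hG := by
  refine lt_of_le_not_ge (fun f hf => mem_functionIdeal.2 (h.1 (mem_functionIdeal.1 hf)))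
    fun hle => h.2 fun Z hZ => ?_
  obtain ⟨f, rfl⟩ := exists_zeroAtInfty_setOf_eq_zero 𝕜 (mem_zeroSets_iff.1 (hG.ssubset.1 hZ))
  exact mem_functionIdeal.1 (hle (mem_functionIdeal.2 hZ))

theorem isPrimeZFilter_zeroSetsOf {P : TwoSidedIdeal C₀(X, 𝕜)} (hP : IsPrimeIdeal P)
    (hz : IsZIdeal P) : IsPrimeZFilter (zeroSetsOf P) where
  isZFilter.nonempty := ⟨_, 0, P.zero_mem, rfl⟩
  isZFilter.ssubset := by
    constructor
    · rintro _ ⟨f, -, rfl⟩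
      exact setOf_eq_zero_mem_zeroSets f
    · exact fun h => hP.ne_top <| eq_top_iff.2 fun f _ =>
        (setOf_eq_zero_mem_zeroSetsOf hz).1 (h (setOf_eq_zero_mem_zeroSets f))
  isZFilter.inter_mem _ hZ _ hW := inter_mem_zeroSetsOf hZ hW
  isZFilter.superset_mem := by
    rintro _ ⟨f, hf, rfl⟩ W hW hfW
    obtain ⟨g, rfl⟩ := exists_zeroAtInfty_setOf_eq_zero 𝕜 (mem_zeroSets_iff.1 hW)
    exact ⟨g, hz f hf g hfW, rfl⟩
  union_notMem Z hZ W hW hZP hWP h := by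
    obtain ⟨f, rfl⟩ := exists_zeroAtInfty_setOf_eq_zero 𝕜 (mem_zeroSets_iff.1 hZ)
    obtain ⟨g, rfl⟩ := exists_zeroAtInfty_setOf_eq_zero 𝕜 (mem_zeroSets_iff.1 hW)
    rw [setOf_eq_zero_mem_zeroSetsOf hz] at hZP hWP
    rw [← setOf_mul_eq_zero, setOf_eq_zero_mem_zeroSetsOf hz] at h
    exact (hP.mem_or_mem f g h).elim hZP hWP

theorem exists_closure_compl_mem_zeroSetsOf {P P' : TwoSidedIdeal C₀(X, 𝕜)}
    (hP' : IsPrimeIdeal P') (h : P' < P) :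
    ∃ Z ∈ zeroSetsOf P, closure Zᶜ ∈ zeroSetsOf P := by
  obtain ⟨hle, f, hf, hf'⟩ := SetLike.lt_iff_le_and_exists.1 h
  obtain ⟨g, hg⟩ := exists_zeroAtInfty_setOf_eq_zero 𝕜 (isClosed_closure (s := {x | f x = 0}ᶜ))
  have hfg : f * g = 0 := by
    ext x
    have hx : f x = 0 ∨ g x = 0 := or_iff_not_imp_left.2 fun hx => hg.ge (subset_closure hx)
    simpa using hx
  have hgP' : g ∈ P' := (hP'.mem_or_mem f g (hfg ▸ P'.zero_mem)).resolve_left hf'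
  exact ⟨_, ⟨f, hf, rfl⟩, g, hle hgP', hg⟩

theorem IsPrimeIdeal.exists_strictAnti {E I : Type*} [NormedAddCommGroup E] [NormedSpace ℝ E]
    [ProperSpace E] [LinearOrder I] (hI : #I ≤ 𝔠) {P P' : TwoSidedIdeal C₀(E, 𝕜)}
    (hP : IsPrimeIdeal P) (hz : IsZIdeal P) (hP' : IsPrimeIdeal P') (h : P' < P) :
    ∃ Q : I → TwoSidedIdeal C₀(E, 𝕜), StrictAnti Q ∧ (∀ i, IsPrimeIdeal (Q i) ∧ IsZIdeal (Q i)) ∧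
      ∀ i, IsMin i → Q i = P := by
  obtain ⟨Z, hZ, hZ'⟩ := exists_closure_compl_mem_zeroSetsOf hP' h
  obtain ⟨F, hFanti, hF, hFmin⟩ := (isPrimeZFilter_zeroSetsOf hP hz).exists_strictAnti hI hZ hZ'
  refine ⟨fun i => functionIdeal 𝕜 (hF i).isZFilter,
    fun i j hij => functionIdeal_lt_functionIdeal _ _ (hFanti hij),
    fun i => ⟨isPrimeIdeal_functionIdeal (hF i), isZIdeal_functionIdeal _⟩, fun i hi => ?_⟩
  simp only [hFmin i hi, functionIdeal_zeroSetsOf hz]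

end FunctionIdeals

end PrimeZ

open PrimeZ Cardinal in
theorem corollary4p6_general {E I : Type*} [NormedAddCommGroup E] [NormedSpace ℝ E] [LinearOrder I]
    (hI : #I ≤ 𝔠) :
    (∀ P : Set (Set E), IsPrimeZFilter P → (∃ P', IsPrimeZFilter P' ∧ P' ⊂ P) →
      ∃ Q : I → Set (Set E), StrictAnti Q ∧ (∀ i, IsPrimeZFilter (Q i)) ∧
        ∀ i, IsMin i → Q i = P) ∧
    ∀ (𝕜 : Type v) [RCLike 𝕜] [ProperSpace E] (P : TwoSidedIdeal C₀(E, 𝕜)),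
      IsPrimeIdeal P → IsZIdeal P → (∃ P', IsPrimeIdeal P' ∧ P' < P) →
      ∃ Q : I → TwoSidedIdeal C₀(E, 𝕜), StrictAnti Q ∧
        (∀ i, IsPrimeIdeal (Q i) ∧ IsZIdeal (Q i)) ∧ ∀ i, IsMin i → Q i = P := by
  refine ⟨fun P hP ⟨P', hP', h⟩ => ?_, fun 𝕜 _ _ P hP hz ⟨P', hP', h⟩ => ?_⟩
  · obtain ⟨Z, hZ, hZ'⟩ := hP'.exists_closure_compl_mem h hP.isZFilter.ssubset.1
    exact hP.exists_strictAnti hI hZ hZ'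
  · exact hP.exists_strictAnti hI hz hP' h

theorem corollary4p6 (κ : Ordinal.{u}) (hκ : κ.card = Cardinal.continuum) :
    (∀ P : Set (Set ℝ), PrimeZ.IsPrimeZFilter P →
      -- `P` is not a minimal prime `z`-filter
      (∃ P' : Set (Set ℝ), PrimeZ.IsPrimeZFilter P' ∧ P' ⊂ P) →
      ∃ Q : Set.Iio κ → Set (Set ℝ), StrictAnti Q ∧ (∀ α, PrimeZ.IsPrimeZFilter (Q α)) ∧
        ∃ h : 0 < κ, Q ⟨0, h⟩ = P) ∧
    (∀ (𝕜 : Type v) [RCLike 𝕜] (P : TwoSidedIdeal C₀(ℝ, 𝕜)),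
      PrimeZ.IsPrimeIdeal P → PrimeZ.IsZIdeal P →
      -- `P` is not a minimal prime ideal
      (∃ P' : TwoSidedIdeal C₀(ℝ, 𝕜), PrimeZ.IsPrimeIdeal P' ∧ P' < P) →
      ∃ Q : Set.Iio κ → TwoSidedIdeal C₀(ℝ, 𝕜), StrictAnti Q ∧
        (∀ α, PrimeZ.IsPrimeIdeal (Q α) ∧ PrimeZ.IsZIdeal (Q α)) ∧
        ∃ h : 0 < κ, Q ⟨0, h⟩ = P) := by
  have hκ₀ : 0 < κ := pos_iff_ne_zero.2 fun h =>
    Cardinal.continuum_ne_zero (by rw [← hκ, h, Ordinal.card_zero])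
  have hmin : IsMin (⟨0, hκ₀⟩ : Set.Iio κ) := fun α _ => Subtype.coe_le_coe.1 zero_le
  have hI : Cardinal.mk (Set.Iio κ) ≤ Cardinal.continuum := by simp [Cardinal.mk_Iio_ordinal, hκ]
  obtain ⟨hfilter, hideal⟩ := corollary4p6_general (E := ℝ) hI
  refine ⟨fun P hP hP' => ?_, fun 𝕜 _ P hP hz hP' => ?_⟩
  · obtain ⟨Q, hQanti, hQ, hQmin⟩ := hfilter P hP hP'
    exact ⟨Q, hQanti, hQ, hκ₀, hQmin _ hmin⟩
  · obtain ⟨Q, hQanti, hQ, hQmin⟩ := hideal 𝕜 P hP hz hP'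
    exact ⟨Q, hQanti, hQ, hκ₀, hQmin _ hmin⟩
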